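/- **Theorem 4.2 (Decomposition Formula).** Let $\mathbb F$ be a field, $m,n\ge 0$, and let $\mathcal M$ be a matroid on $[m]=\{1,\dots,m\}$ represented over $\mathbb F$ by vectors $\rho_1,\dots,\rho_m\in\mathbb F^n$, i.e. $J\subseteq[m]$ is independent in $\mathcal M$ if and only if the family $(\rho_j)_{j\in J}$ is linearly independent. *Notation.* For a finite arrangement $\mathcal A$ in an affine space $V$ over $\mathbb F$, let $M(\mathcal A)=V\setminus\bigcup_{H\in\mathcal A}H$, let $L(\mathcal A)$ be the set of all nonempty intersections of members of $\mathcal A$ (including $V$), ordered by reverse inclusion, with Möbius function $\mu$, and let $\chi(\mathcal A,t)=\sum_{Y\in L(\mathcal A)}\mu(V,Y)\,t^{\dim Y}$, with the usual convention that $\chi(\mathcal A,t)=0$ if $V$ itself is a member of $\mathcal A$. For $X\in L(\mathcal A)$ let $\mathcal A/X$ be the arrangement in $X$ that consists of all $H\cap X$ with $H\in\mathcal A$ and $X\not\subseteq H$. For $g\in\mathbb F^m$ let $\mathcal A_g$ be the arrangement in $\mathbb F^n$ with the members $\{x:\rho_i\cdot x=g_i\}$, $1\le i\le m$ (if $\rho_i=0$,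 this set is all of $\mathbb F^n$ or empty; an empty member contributes nothing). For each circuit $I$ of $\mathcal M$ let $c_I\in\mathbb F^m$ be the vector, unique up to a nonzero scalar, with support $I$ and $\sum_{i}c_{I,i}\,\rho_i=0$, and let $\mathcal A^\rho$ be the arrangement in $\mathbb F^m$ of the hyperplanes $\{y: c_I\cdot y=0\}$, for all circuits $I$ of $\mathcal M$. *Claim.* For every $X\in L(\mathcal A^\rho)$ the polynomial $\chi(\mathcal A_g,t)$ is the same for all $g\in M(\mathcal A^\rho/X)$; denote it by $\chi(X,t)$. If $\mathbb F$ is a finite field with $q$ elements, then $$\sum_{X\in L(\mathcal A^\rho)}\chi(X,q)\,\chi(\mathcal A^\rho/X,q)=q^n(q-1)^m ,$$ where $\chi(X,t):=0$ if $M(\mathcal A^\rho/X)=\emptyset$; in that case $\chi(\mathcal A^\rho/X,q)=0$, so the choice of this value does not matter. If $\mathbb F$ is infinite, then $M(\mathcal A^\rho/X)\neq\emptyset$ for every $X\in L(\mathcal A^\rho)$, and $$\sum_{X\in L(\mathcal A^\rho)}\chi(X,t)\,\chi(\mathcal A^\rho/X,t)=t^n(t-1)^m .$$ -/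

import Mathlib

namespace HypArr

section Arrangements

variable {F V : Type*} [Field F] [AddCommGroup V] [Module F V]

open Classical in
/-- The intersection semi-lattice of a finite family `A` of affine subspaces, regarded as an
arrangement in the ambient affine space `W`: all nonempty intersections of `W` with members of
`A`, including `W` itself (the empty intersection). -/
noncomputable def flats (W : AffineSubspace F V) (A : Finset (AffineSubspace F V)) :
    Finset (AffineSubspace F V) :=
  (A.powerset.image fun S => W ⊓ S.inf id).filter fun X => X ≠ ⊥

theorem ambient_mem_flats {W X : AffineSubspace F V} {A : Finset (AffineSubspace F V)}
    (hX : X ∈ flats W A) : W ∈ flats W A := by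
  classical
  simp only [flats, Finset.mem_filter, Finset.mem_image, Finset.mem_powerset] at hX ⊢
  obtain ⟨⟨S, -, rfl⟩, h⟩ := hX
  refine ⟨⟨∅, by simp, by simp⟩, ?_⟩
  rintro rfl
  simp at h

/-- The intersection semi-lattice as a poset, ordered by reverse inclusion. -/
abbrev FlatPoset (W : AffineSubspace F V) (A : Finset (AffineSubspace F V)) : Type _ :=
  {X : AffineSubspace F V // X ∈ flats W A}ᵒᵈ

open Classical in
noncomputable instance instLocallyFiniteOrderFlatPoset (W : AffineSubspace F V)
    (A : Finset (AffineSubspace F V)) : LocallyFiniteOrder (FlatPoset W A) :=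
  Fintype.toLocallyFiniteOrder

open Classical in
/-- The characteristic polynomial `∑ μ(W, X) t ^ dim X`, summed over the intersection
semi-lattice, of the arrangement `A` in the ambient affine space `W`, where `μ` is the Möbius
function. Empty members of `A` do not contribute to the semi-lattice. If some member of `A` is
degenerate, i.e. contains the whole ambient space, then the complement of `A` is empty and the
characteristic polynomial is `0`, as usual (compare: the characteristic polynomial of a matroid
with a loop is `0`). -/
noncomputable def charPoly (W : AffineSubspace F V) (A : Finset (AffineSubspace F V)) :
    Polynomial ℤ :=
  if ∃ H ∈ A, W ≤ H then 0
  else ∑ X : {X : AffineSubspace F V // X ∈ flats W A},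
    Polynomial.C (IncidenceAlgebra.mu ℤ
      (OrderDual.toDual ⟨W, ambient_mem_flats X.2⟩ : FlatPoset W A) (OrderDual.toDual X)) *
      Polynomial.X ^ Module.finrank F X.1.direction

/-- The complement `M(A)` of the arrangement `A` in the ambient affine space `W`. -/
def complement (W : AffineSubspace F V) (A : Finset (AffineSubspace F V)) : Set V :=
  {v | v ∈ W ∧ ∀ H ∈ A, v ∉ H}

open Classical in
/-- The restriction `A / X`: the arrangement in the ambient space `X` that consists of all
`H ∩ X` with `H ∈ A` and `X ⊈ H`. -/
noncomputable def restriction (A : Finset (AffineSubspace F V)) (X : AffineSubspace F V) :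
    Finset (AffineSubspace F V) :=
  (A.filter fun H => ¬ X ≤ H).image fun H => H ⊓ X

end Arrangements

section Matroids

variable {F : Type*} [Field F] {m n : ℕ}

/-- The affine subspace `{x | a · x = c}` of `F ^ k`; a hyperplane when `a ≠ 0`. -/
def hyperplane {k : ℕ} (a : Fin k → F) (c : F) : AffineSubspace F (Fin k → F) where
  carrier := {x | a ⬝ᵥ x = c}
  smul_vsub_vadd_mem' := by
    intro r p₁ p₂ p₃ h₁ h₂ h₃
    simp only [Set.mem_ofPred_eq] at h₁ h₂ h₃ ⊢
    simp [dotProduct_add, dotProduct_sub, dotProduct_smul, h₁, h₂, h₃]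

/-- `ρ` represents over `F` the matroid `M` on the ground set `{1, …, m}`. -/
def IsRepresentation (M : Matroid (Fin m)) (ρ : Fin m → Fin n → F) : Prop :=
  M.E = Set.univ ∧ ∀ J : Set (Fin m), M.Indep J ↔ LinearIndepOn F ρ J

open Classical in
/-- The translated arrangement `A_g`, with the members `ρ_i · x = g_i`. -/
noncomputable def translate (ρ : Fin m → Fin n → F) (g : Fin m → F) :
    Finset (AffineSubspace F (Fin n → F)) :=
  Finset.univ.image fun i => hyperplane (ρ i) (g i)

/-- `c` is a linear relation among the vectors `ρ_i` whose support is exactly `I`. For a circuit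
`I` this says that `c` is a circuit vector of `I`. -/
def IsCircuitVector (ρ : Fin m → Fin n → F) (I : Finset (Fin m)) (c : Fin m → F) : Prop :=
  ∑ i, c i • ρ i = 0 ∧ ∀ i, c i ≠ 0 ↔ i ∈ I

theorem exists_isCircuitVector {M : Matroid (Fin m)} {ρ : Fin m → Fin n → F}
    (hρ : IsRepresentation M ρ) {I : Finset (Fin m)} (hI : M.IsCircuit (I : Set (Fin m))) :
    ∃ c, IsCircuitVector ρ I c := by
  classical
  have hd : ¬ LinearIndepOn F ρ (I : Set (Fin m)) := fun h => hI.not_indep ((hρ.2 _).2 h)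
  obtain ⟨f, hf, i₀, hi₀, hne⟩ := not_linearIndepOn_finset_iff.1 hd
  refine ⟨fun i => if i ∈ I then f i else 0, ?_, ?_⟩
  · simpa [ite_smul, Finset.sum_ite_mem] using hf
  · intro i
    by_cases hi : i ∈ I
    · simp only [hi, if_true, iff_true]
      intro h0
      have hind : M.Indep ((I.erase i : Finset (Fin m)) : Set (Fin m)) :=
        hI.ssubset_indep (by exact_mod_cast Finset.erase_ssubset hi)
      have hl := linearIndepOn_finset_iff.1 ((hρ.2 _).1 hind) f
      rw [← Finset.add_sum_erase _ _ hi, h0, zero_smul, zero_add] at hf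
      have hii : i₀ ≠ i := by rintro rfl; exact hne h0
      exact hne (hl hf i₀ (Finset.mem_erase.2 ⟨hii, hi₀⟩))
    · simp [hi]

/-- Circuit vectors are unique up to a nonzero scalar, so all circuit vectors of a circuit define
the same hyperplane. -/
theorem hyperplane_circuitVector_eq {M : Matroid (Fin m)} {ρ : Fin m → Fin n → F}
    (hρ : IsRepresentation M ρ) {I : Finset (Fin m)} (hI : M.IsCircuit (I : Set (Fin m)))
    {c d : Fin m → F} (hc : IsCircuitVector ρ I c) (hd : IsCircuitVector ρ I d) :
    hyperplane c 0 = hyperplane d 0 := by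
  classical
  obtain ⟨i, hi⟩ : I.Nonempty := by exact_mod_cast hI.nonempty
  have hci := (hc.2 i).2 hi
  have hdi := (hd.2 i).2 hi
  have key : ∀ j, d i * c j = c i * d j := by
    have hind : M.Indep ((I.erase i : Finset (Fin m)) : Set (Fin m)) :=
      hI.ssubset_indep (by exact_mod_cast Finset.erase_ssubset hi)
    have hl := linearIndepOn_finset_iff.1 ((hρ.2 _).1 hind) (fun j => d i * c j - c i * d j)
    have h0 : ∀ j, j ∉ I.erase i → d i * c j - c i * d j = 0 := by
      intro j hj
      by_cases hji : j = i
      · subst hji; ring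
      · have hjI : j ∉ I := fun h => hj (Finset.mem_erase.2 ⟨hji, h⟩)
        have h1 : c j = 0 := by
          by_contra h
          exact hjI ((hc.2 j).1 h)
        have h2 : d j = 0 := by
          by_contra h
          exact hjI ((hd.2 j).1 h)
        simp [h1, h2]
    have hs : ∑ j ∈ I.erase i, (d i * c j - c i * d j) • ρ j = 0 := by
      rw [Finset.sum_subset (Finset.subset_univ _) (fun j _ hj => by simp [h0 j hj])]
      simp [sub_smul, mul_smul, Finset.sum_sub_distrib, ← Finset.smul_sum, hc.1, hd.1]
    intro j
    by_cases hj : j ∈ I.erase i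
    · exact sub_eq_zero.1 (hl hs j hj)
    · exact sub_eq_zero.1 (h0 j hj)
  have hvec : d i • c = c i • d := funext fun j => by simpa using key j
  ext x
  have hdot : d i * (c ⬝ᵥ x) = c i * (d ⬝ᵥ x) := by
    have := congrArg (fun v => v ⬝ᵥ x) hvec
    simpa [smul_dotProduct] using this
  change c ⬝ᵥ x = 0 ↔ d ⬝ᵥ x = 0
  constructor
  · intro h
    rw [h, mul_zero] at hdot
    exact (mul_eq_zero.1 hdot.symm).resolve_left hci
  · intro h
    rw [h, mul_zero] at hdot
    exact (mul_eq_zero.1 hdot).resolve_left hdi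

open Classical in
/-- A chosen circuit vector `c_I` of the circuit `I`. (If there is none, the value `0` is
irrelevant; every circuit of a represented matroid has one.) -/
noncomputable def circuitVector (ρ : Fin m → Fin n → F) (I : Finset (Fin m)) : Fin m → F :=
  if h : ∃ c, IsCircuitVector ρ I c then h.choose else 0

open Classical in
/-- The arrangement `A^ρ` in `F ^ m`: the hyperplanes `H_I : c_I · y = 0`, for the circuits `I`
of the matroid `M` represented by `ρ`. -/
noncomputable def circuitArr (M : Matroid (Fin m)) (ρ : Fin m → Fin n → F) :
    Finset (AffineSubspace F (Fin m → F)) :=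
  (Finset.univ.filter fun I : Finset (Fin m) => M.IsCircuit (I : Set (Fin m))).image
    fun I => hyperplane (circuitVector ρ I) 0

open Classical in
/-- The polynomial `χ(X, t)`: the characteristic polynomial of `A_g` for `g ∈ M(A^ρ / X)`, with
the value `0` if `M(A^ρ / X)` is empty. -/
noncomputable def flatPoly (M : Matroid (Fin m)) (ρ : Fin m → Fin n → F)
    (X : AffineSubspace F (Fin m → F)) : Polynomial ℤ :=
  if h : (complement X (restriction (circuitArr M ρ) X)).Nonempty then
    charPoly ⊤ (translate ρ h.choose)
  else 0

end Matroids

end HypArr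

/-! Write `C_S` for the space `consistent ρ S` of those `g` whose equations indexed by `S` have a
common solution. Whitney's theorem turns `χ(A_g, t)` into the sum of `(-1)^|S| t^(dim ker)` over the
`S` with `g ∈ C_S`, where `ker` is the common kernel of the `ρ_i`, `i ∈ S`. The linear relations
supported in `S` are spanned by circuit vectors, so `C_S` is a flat of `A^ρ`. Hence for `g` generic
in a flat `X`, `g ∈ C_S` means `X ≤ C_S`, and `χ(A_g, t)` depends only on `X`.

Now exchange the sums over `X` and `S`. For fixed `S`, Möbius inversion sums `χ(A^ρ/X, t)` over `X ≤
C_S` to `t^(dim C_S)`. Rank-nullity gives `dim ker + dim C_S = n + m - |S|`, and the binomial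
theorem finishes.

This is a polynomial identity over every field for `genericPoly`, which agrees with `flatPoly`
wherever a generic point exists. Over an infinite field one always does. Over a finite field with
`q` elements, its absence forces `χ(A^ρ/X, q) = 0`, since this value counts the generic points. -/

namespace HypArr

/-! ### Möbius functions of locally finite posets -/

section Moebius

/-- The Möbius function is determined by the vanishing of its sums over intervals. -/
theorem eq_mu_of_sum_Icc {P : Type*} [PartialOrder P] [LocallyFiniteOrder P] [DecidableEq P]
    [WellFoundedLT P] (a : P) (f : P → ℤ)
    (hf : ∀ b, a ≤ b → ∑ x ∈ Finset.Icc a b, f x = if a = b then 1 else 0) :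
    ∀ b, a ≤ b → f b = IncidenceAlgebra.mu ℤ a b := by
  intro b
  induction b using WellFoundedLT.induction with
  | ind b ih =>
    intro hab
    have h := (hf b hab).trans (IncidenceAlgebra.sum_Icc_mu_right (𝕜 := ℤ) a b).symm
    rw [← Finset.Ico_insert_right hab, Finset.sum_insert (by simp), Finset.sum_insert (by simp),
      Finset.sum_congr rfl fun x hx => ih x (Finset.mem_Ico.1 hx).2 (Finset.mem_Ico.1 hx).1] at h
    exact add_right_cancel h

/-- The Möbius function is preserved by embeddings that preserve the intervals. -/
theorem mu_map_orderEmbedding {P Q : Type*} [PartialOrder P] [LocallyFiniteOrder P] [DecidableEq P]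
    [WellFoundedLT P] [PartialOrder Q] [LocallyFiniteOrder Q] [DecidableEq Q] (e : P ↪o Q)
    (a : P) (he : ∀ y, e a ≤ y → ∃ x, e x = y) {b : P} (hab : a ≤ b) :
    IncidenceAlgebra.mu ℤ (e a) (e b) = IncidenceAlgebra.mu ℤ a b := by
  refine eq_mu_of_sum_Icc a (fun x => IncidenceAlgebra.mu ℤ (e a) (e x)) (fun b _ => ?_) b hab
  have h := IncidenceAlgebra.sum_Icc_mu_right (𝕜 := ℤ) (e a) (e b)
  simp only [e.injective.eq_iff] at h
  rw [← h]
  -- By `he`, the embedding maps `Icc a b` onto `Icc (e a) (e b)`.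
  refine Finset.sum_bij (fun x _ => e x) (fun x hx => ?_) (fun _ _ _ _ h => e.injective h)
    (fun y hy => ?_) (fun _ _ => rfl)
  · simpa using hx
  · obtain ⟨x, rfl⟩ := he y (Finset.mem_Icc.1 hy).1
    exact ⟨x, by simpa using hy, rfl⟩

end Moebius

/-! ### Flats and Whitney's theorem -/

section Arrangements

variable {F V : Type*} [Field F] [AddCommGroup V] [Module F V]

-- A canonical presentation: any members cutting out `X` may be enlarged to all members containing
-- `X`.
open Classical in
theorem mem_flats_iff {W X : AffineSubspace F V} {A : Finset (AffineSubspace F V)} :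
    X ∈ flats W A ↔ X ≠ ⊥ ∧ X = W ⊓ (A.filter fun H => X ≤ H).inf id := by
  simp only [flats, Finset.mem_filter, Finset.mem_image, Finset.mem_powerset]
  constructor
  · rintro ⟨⟨S, hS, rfl⟩, hX⟩
    refine ⟨hX, le_antisymm ?_ ?_⟩
    · exact le_inf inf_le_left (Finset.le_inf fun H hH => (Finset.mem_filter.1 hH).2)
    · refine inf_le_inf_left _ (Finset.inf_mono fun H hH => Finset.mem_filter.2 ⟨hS hH, ?_⟩)
      exact inf_le_right.trans (Finset.inf_le (f := id) hH)
  · rintro ⟨hX, h⟩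
    exact ⟨⟨_, Finset.filter_subset _ _, h.symm⟩, hX⟩

theorem le_of_mem_flats {W X : AffineSubspace F V} {A : Finset (AffineSubspace F V)}
    (hX : X ∈ flats W A) : X ≤ W := by
  rw [(mem_flats_iff.1 hX).2]
  exact inf_le_left

open Classical in
theorem inf_mem_flats {W : AffineSubspace F V} {A S : Finset (AffineSubspace F V)}
    (hS : S ⊆ A) (h : W ⊓ S.inf id ≠ ⊥) : W ⊓ S.inf id ∈ flats W A := by
  simp only [flats, Finset.mem_filter, Finset.mem_image, Finset.mem_powerset]
  exact ⟨⟨S, hS, rfl⟩, h⟩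

/-- Replacing a member `H` by `H ⊓ X` changes nothing inside `X`, so the semi-lattice of `A / X` is
the part of that of `A` lying above `X` in reverse inclusion. -/
theorem mem_flats_restriction_iff {W X Y : AffineSubspace F V}
    {A : Finset (AffineSubspace F V)} (hX : X ∈ flats W A) :
    Y ∈ flats X (restriction A X) ↔ Y ∈ flats W A ∧ Y ≤ X := by
  classical
  constructor
  · intro hY
    have hYX := le_of_mem_flats hY
    obtain ⟨hne, h⟩ := mem_flats_iff.1 hY
    refine ⟨mem_flats_iff.2 ⟨hne, le_antisymm ?_ ?_⟩, hYX⟩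
    · exact le_inf (hYX.trans (le_of_mem_flats hX))
        (Finset.le_inf fun H hH => (Finset.mem_filter.1 hH).2)
    · have hX' : W ⊓ (A.filter fun H => Y ≤ H).inf id ≤ X := by
        conv_rhs => rw [(mem_flats_iff.1 hX).2]
        refine inf_le_inf_left _ (Finset.inf_mono fun H hH => ?_)
        rw [Finset.mem_filter] at hH ⊢
        exact ⟨hH.1, hYX.trans hH.2⟩
      conv_rhs => rw [h]
      refine le_inf hX' (Finset.le_inf fun K hK => ?_)
      obtain ⟨hK, hYK⟩ := Finset.mem_filter.1 hK
      obtain ⟨H, hH, rfl⟩ := Finset.mem_image.1 hK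
      refine le_inf (inf_le_right.trans (Finset.inf_le (f := id) ?_)) hX'
      exact Finset.mem_filter.2 ⟨(Finset.mem_filter.1 hH).1, hYK.trans inf_le_left⟩
  · rintro ⟨hY, hYX⟩
    obtain ⟨hne, h⟩ := mem_flats_iff.1 hY
    refine mem_flats_iff.2 ⟨hne, le_antisymm ?_ ?_⟩
    · exact le_inf hYX (Finset.le_inf fun H hH => (Finset.mem_filter.1 hH).2)
    · conv_rhs => rw [h]
      refine le_inf (inf_le_left.trans (le_of_mem_flats hX)) (Finset.le_inf fun H hH => ?_)
      obtain ⟨hHA, hYH⟩ := Finset.mem_filter.1 hH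
      by_cases hXH : X ≤ H
      · exact inf_le_left.trans hXH
      · refine (inf_le_right.trans (Finset.inf_le (f := id) (b := H ⊓ X) ?_)).trans inf_le_left
        exact Finset.mem_filter.2
          ⟨Finset.mem_image.2 ⟨H, Finset.mem_filter.2 ⟨hHA, hXH⟩, rfl⟩, le_inf hYH hYX⟩

/-- Whitney's theorem: the characteristic polynomial of the arrangement with the members `H i`,
possibly repeated, as a sum over all subfamilies with nonempty intersection. -/
theorem charPoly_eq_sum_powerset [DecidableEq (AffineSubspace F V)] {ι : Type*}
    (W : AffineSubspace F V) (s : Finset ι) (H : ι → AffineSubspace F V)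
    [∀ S : Finset ι, Decidable (W ⊓ S.inf H ≠ ⊥)] :
    charPoly W (s.image H) = ∑ S ∈ s.powerset, if W ⊓ S.inf H ≠ ⊥ then
      (-1 : Polynomial ℤ) ^ S.card * Polynomial.X ^ Module.finrank F (W ⊓ S.inf H).direction
      else 0 := by
  classical
  rw [charPoly]
  split_ifs with hdeg
  · obtain ⟨H', hH', hW⟩ := hdeg
    obtain ⟨i, hi, rfl⟩ := Finset.mem_image.1 hH'
    -- As `W ≤ H i`, adding `i` to `S` keeps the intersection and flips the sign: the terms cancel
    -- in pairs.
    rw [← Finset.insert_erase hi, Finset.sum_powerset_insert (Finset.notMem_erase i s),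
      ← Finset.sum_add_distrib, Finset.sum_eq_zero]
    intro S hS
    have hiS : i ∉ S := fun h => Finset.notMem_erase i s (Finset.mem_powerset.1 hS h)
    have hinf : W ⊓ (insert i S).inf H = W ⊓ S.inf H := by
      rw [Finset.inf_insert, ← inf_assoc, inf_eq_left.2 hW]
    rw [Finset.card_insert_of_notMem hiS]
    by_cases h : W ⊓ S.inf H = ⊥
    · rw [if_neg (by simpa using h), if_neg (not_not.2 (hinf.trans h)), add_zero]
    · rw [if_pos h, if_pos (hinf ▸ h), hinf]
      ring
  · push Not at hdeg
    have hmaps : ∀ S ∈ s.powerset.filter (fun S => W ⊓ S.inf H ≠ ⊥),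
        W ⊓ S.inf H ∈ flats W (s.image H) := by
      intro S hS
      obtain ⟨hS, hne⟩ := Finset.mem_filter.1 hS
      have himg : (S.image H).inf id = S.inf H := by rw [Finset.inf_image]; rfl
      rw [← himg] at hne ⊢
      exact inf_mem_flats (Finset.image_subset_image (Finset.mem_powerset.1 hS)) hne
    rw [← Finset.sum_filter, ← Finset.sum_fiberwise_of_maps_to hmaps,
      ← Finset.sum_coe_sort (flats W (s.image H))]
    refine Finset.sum_congr rfl fun X _ => ?_
    -- Group the subfamilies by their intersection. The signed count over one flat is its Möbius
    -- value, because its sum over `[W, Y]` runs over all subsets of the members containing `Y`.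
    have hmu := eq_mu_of_sum_Icc (P := FlatPoset W (s.image H))
      (OrderDual.toDual ⟨W, ambient_mem_flats X.2⟩)
      (fun Y => ∑ S ∈ s.powerset.filter (fun S => W ⊓ S.inf H = (OrderDual.ofDual Y).1),
        (-1 : ℤ) ^ S.card) ?_ (OrderDual.toDual X) (le_of_mem_flats X.2)
    · have hfilter : (s.powerset.filter fun S => W ⊓ S.inf H ≠ ⊥).filter
          (fun S => W ⊓ S.inf H = X.1) = s.powerset.filter (fun S => W ⊓ S.inf H = X.1) := by
        rw [Finset.filter_filter]
        refine Finset.filter_congr fun S _ => and_iff_right_of_imp ?_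
        rintro h
        rw [h]
        exact (mem_flats_iff.1 X.2).1
      rw [hfilter, Finset.sum_congr rfl fun S hS => by rw [(Finset.mem_filter.1 hS).2],
        ← Finset.sum_mul]
      congr 1
      refine Eq.trans (congrArg Polynomial.C (Eq.trans ?_ hmu.symm)) ?_
      · congr!
      · rw [map_sum]
        exact Finset.sum_congr (by congr!) fun S _ => by simp
    · intro Y hY
      obtain ⟨Y, rfl⟩ := OrderDual.toDual.surjective Y
      have hYne := (mem_flats_iff.1 Y.2).1
      have hYW := le_of_mem_flats Y.2
      have hsum : ∑ Z ∈ Finset.Icc (OrderDual.toDual ⟨W, ambient_mem_flats X.2⟩ :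
          FlatPoset W (s.image H)) (OrderDual.toDual Y),
          ∑ S ∈ s.powerset.filter (fun S => W ⊓ S.inf H = (OrderDual.ofDual Z).1),
            (-1 : ℤ) ^ S.card = ∑ S ∈ (s.filter fun i => Y.1 ≤ H i).powerset, (-1 : ℤ) ^ S.card := by
        rw [← Finset.sum_biUnion]
        · refine Finset.sum_congr ?_ fun _ _ => rfl
          ext S
          simp only [Finset.mem_biUnion, Finset.mem_filter, Finset.mem_powerset, Finset.mem_Icc]
          constructor
          · rintro ⟨Z, ⟨-, hZ⟩, hS, h⟩ i hi
            refine Finset.mem_filter.2 ⟨hS hi, ?_⟩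
            have hZ' : Y.1 ≤ (OrderDual.ofDual Z).1 := hZ
            rw [← h] at hZ'
            exact hZ'.trans (inf_le_right.trans (Finset.inf_le hi))
          · intro hS
            have hle : Y.1 ≤ W ⊓ S.inf H :=
              le_inf hYW (Finset.le_inf fun i hi => (Finset.mem_filter.1 (hS hi)).2)
            have hSs : S ⊆ s := hS.trans (Finset.filter_subset _ _)
            have hmem := hmaps S (Finset.mem_filter.2 ⟨Finset.mem_powerset.2 hSs,
              fun h => hYne (le_bot_iff.1 (h ▸ hle))⟩)
            exact ⟨OrderDual.toDual ⟨_, hmem⟩, ⟨le_of_mem_flats hmem, hle⟩, hSs, rfl⟩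
        · intro Z _ Z' _ hZ
          refine Finset.disjoint_left.2 fun S hS hS' => hZ ?_
          have h := (Finset.mem_filter.1 hS).2.symm.trans (Finset.mem_filter.1 hS').2
          exact OrderDual.ofDual.injective (Subtype.ext h)
      rw [hsum, Finset.sum_powerset_neg_one_pow_card]
      -- A flat contained in no member is `W`; the converse uses that no member contains `W`.
      refine if_congr ?_ rfl rfl
      rw [OrderDual.toDual_inj, Subtype.ext_iff]
      constructor
      · intro h
        refine le_antisymm ?_ hYW
        rw [(mem_flats_iff.1 Y.2).2]
        refine le_inf le_rfl (Finset.le_inf fun K hK => ?_)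
        obtain ⟨hK, hYK⟩ := Finset.mem_filter.1 hK
        obtain ⟨i, hi, rfl⟩ := Finset.mem_image.1 hK
        exact absurd hYK (Finset.filter_eq_empty_iff.1 h hi)
      · intro h
        refine Finset.filter_eq_empty_iff.2 fun i hi hYi => ?_
        exact hdeg _ (Finset.mem_image_of_mem _ hi) (h.trans_le hYi)

/-! ### The finite field method -/

theorem mem_finset_inf_iff {ι : Type*} {S : Finset ι} {H : ι → AffineSubspace F V} {v : V} :
    v ∈ S.inf H ↔ ∀ i ∈ S, v ∈ H i := by
  classical
  induction S using Finset.induction_on with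
  | empty => simp
  | insert i S _ ih => rw [Finset.inf_insert, AffineSubspace.mem_inf_iff, ih]; simp

theorem card_affineSubspace [Finite V] {X : AffineSubspace F V} (hX : X ≠ ⊥) :
    Nat.card X = Nat.card F ^ Module.finrank F X.direction := by
  obtain ⟨p, hp⟩ := (AffineSubspace.nonempty_iff_ne_bot X).2 hX
  rw [← Module.natCard_eq_pow_finrank (K := F) (V := X.direction)]
  refine Nat.card_congr
    { toFun := fun x => ⟨x.1 -ᵥ p, AffineSubspace.vsub_mem_direction x.2 hp⟩
      invFun := fun v => ⟨v.1 +ᵥ p, AffineSubspace.vadd_mem_of_mem_direction v.2 hp⟩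
      left_inv := fun x => by simp
      right_inv := fun v => by simp }

/-- The finite field method: over a finite field with `q` elements, the value of the
characteristic polynomial at `q` is the number of points of the complement. -/
theorem charPoly_eval_natCard [Finite V] (W : AffineSubspace F V)
    (A : Finset (AffineSubspace F V)) :
    (charPoly W A).eval (Nat.card F : ℤ) = Nat.card (complement W A) := by
  classical
  have := Fintype.ofFinite V
  have hA : A = A.image id := by simp
  conv_lhs => rw [hA]
  rw [charPoly_eq_sum_powerset, Polynomial.eval_finsetSum]
  -- Each Whitney term at `q` is a signed count of the points of the intersection, correctly `0`
  -- when it is empty.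
  have hterm : ∀ S ∈ A.powerset, Polynomial.eval (Nat.card F : ℤ)
      (if W ⊓ S.inf id ≠ ⊥ then (-1 : Polynomial ℤ) ^ S.card *
        Polynomial.X ^ Module.finrank F (W ⊓ S.inf id).direction else 0) =
      ∑ v : V, if v ∈ W ∧ ∀ H ∈ S, v ∈ H then (-1 : ℤ) ^ S.card else 0 := by
    intro S _
    have hmem : ∀ v : V, (v ∈ W ∧ ∀ H ∈ S, v ∈ H) ↔ v ∈ W ⊓ S.inf id := fun v => by
      rw [AffineSubspace.mem_inf_iff, mem_finset_inf_iff]; rfl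
    simp only [hmem]
    rw [← Finset.sum_filter, Finset.sum_const, ← Fintype.card_subtype, ← Nat.card_eq_fintype_card,
      nsmul_eq_mul]
    split_ifs with h
    · have := card_affineSubspace h
      change Nat.card {v // v ∈ W ⊓ S.inf id} = _ at this
      rw [this]
      simp [mul_comm]
    · rw [not_not] at h
      simp [h]
  rw [Finset.sum_congr rfl hterm, Finset.sum_comm]
  -- Inclusion-exclusion at one point: only subsets of the members through `v` contribute, and their
  -- signs cancel unless there are none.
  have hv : ∀ v : V, (∑ S ∈ A.powerset, if v ∈ W ∧ ∀ H ∈ S, v ∈ H then (-1 : ℤ) ^ S.card else 0) =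
      if v ∈ complement W A then 1 else 0 := by
    intro v
    by_cases hvW : v ∈ W
    · have : A.powerset.filter (fun S => v ∈ W ∧ ∀ H ∈ S, v ∈ H) =
          (A.filter fun H => v ∈ H).powerset := by
        ext S
        simp only [Finset.mem_filter, Finset.mem_powerset, hvW, true_and]
        exact ⟨fun h H hH => Finset.mem_filter.2 ⟨h.1 hH, h.2 H hH⟩, fun h =>
          ⟨fun H hH => (Finset.mem_filter.1 (h hH)).1, fun H hH => (Finset.mem_filter.1 (h hH)).2⟩⟩
      rw [← Finset.sum_filter, this, Finset.sum_powerset_neg_one_pow_card]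
      refine if_congr ?_ rfl rfl
      rw [Finset.filter_eq_empty_iff]
      exact ⟨fun h => ⟨hvW, fun H hH => h hH⟩, fun h H hH => h.2 H hH⟩
    · have : v ∉ complement W A := fun h => hvW h.1
      simp [hvW, this]
  rw [Finset.sum_congr rfl fun v _ => hv v, Finset.sum_boole, ← Fintype.card_subtype,
    ← Nat.card_eq_fintype_card]

/-! ### Möbius inversion over restrictions -/

/-- The flats of `A / X` form an upper set of the poset of `A`, so both have the same Möbius values
there. A restriction is never degenerate, since members containing `X` are dropped. -/
theorem charPoly_restriction {W : AffineSubspace F V}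
    {A : Finset (AffineSubspace F V)} (X : FlatPoset W A)
    [DecidableEq (FlatPoset W A)] [DecidablePred fun Y : FlatPoset W A => X ≤ Y] :
    charPoly (OrderDual.ofDual X).1 (restriction A (OrderDual.ofDual X).1) =
      ∑ Y : FlatPoset W A, if X ≤ Y then
        Polynomial.C (IncidenceAlgebra.mu ℤ X Y) *
          Polynomial.X ^ Module.finrank F (OrderDual.ofDual Y).1.direction else 0 := by
  classical
  obtain ⟨⟨X, hX⟩, rfl⟩ := OrderDual.toDual.surjective X
  have hiff := fun Y => mem_flats_restriction_iff (Y := Y) hX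
  rw [charPoly, if_neg]
  · let e : FlatPoset X (restriction A X) ↪o FlatPoset W A :=
      OrderEmbedding.ofMapLEIff (fun Y => OrderDual.toDual
        ⟨(OrderDual.ofDual Y).1, ((hiff _).1 (OrderDual.ofDual Y).2).1⟩) fun _ _ => Iff.rfl
    rw [← Finset.sum_filter]
    refine Finset.sum_bij (fun Y _ => e (OrderDual.toDual Y)) (fun Y _ => ?_)
      (fun Y _ Z _ h => OrderDual.toDual.injective (e.injective h)) (fun Y hY => ?_)
      (fun Y _ => ?_)
    · exact Finset.mem_filter.2 ⟨Finset.mem_univ _, ((hiff _).1 Y.2).2⟩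
    · have hYX : (OrderDual.ofDual Y).1 ≤ X := (Finset.mem_filter.1 hY).2
      exact ⟨⟨_, (hiff _).2 ⟨(OrderDual.ofDual Y).2, hYX⟩⟩, Finset.mem_univ _, rfl⟩
    · congr 2
      refine Eq.trans ?_ (mu_map_orderEmbedding e
        (OrderDual.toDual ⟨X, ambient_mem_flats Y.2⟩) ?_
        (b := OrderDual.toDual Y) (le_of_mem_flats Y.2)).symm
      · change _ = IncidenceAlgebra.mu ℤ (OrderDual.toDual 
          (⟨X, _⟩ : {Y // Y ∈ flats X (restriction A X)})) _
        congr!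
      · intro Z hZ
        have hZX : (OrderDual.ofDual Z).1 ≤ X := hZ
        exact ⟨OrderDual.toDual ⟨_, (hiff _).2 ⟨(OrderDual.ofDual Z).2, hZX⟩⟩, rfl⟩
  · rintro ⟨K, hK, hXK⟩
    obtain ⟨H, hH, rfl⟩ := Finset.mem_image.1 hK
    exact (Finset.mem_filter.1 hH).2 (hXK.trans inf_le_left)

/-- Möbius inversion for the characteristic polynomials of the restrictions. -/
theorem sum_charPoly_restriction {W R : AffineSubspace F V} {A : Finset (AffineSubspace F V)}
    (hR : R ∈ flats W A) [DecidablePred fun X : AffineSubspace F V => X ≤ R] :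
    (∑ X ∈ flats W A, if X ≤ R then charPoly X (restriction A X) else 0) =
      Polynomial.X ^ Module.finrank F R.direction := by
  classical
  rw [← Finset.sum_coe_sort (flats W A)]
  let R' : FlatPoset W A := OrderDual.toDual ⟨R, hR⟩
  have h1 : (∑ X : {X // X ∈ flats W A}, if X.1 ≤ R then charPoly X.1 (restriction A X.1) else 0) =
      ∑ X : FlatPoset W A, ∑ Y : FlatPoset W A, if R' ≤ X ∧ X ≤ Y then
        Polynomial.C (IncidenceAlgebra.mu ℤ X Y) *
          Polynomial.X ^ Module.finrank F (OrderDual.ofDual Y).1.direction else 0 := by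
    refine Finset.sum_congr rfl fun X _ => ?_
    by_cases h : X.1 ≤ R
    · have h' : R' ≤ OrderDual.toDual X := h
      rw [if_pos h]
      refine (charPoly_restriction (OrderDual.toDual X)).trans ?_
      exact Finset.sum_congr rfl fun Y _ => if_congr (and_iff_right h').symm rfl rfl
    · have h' : ¬ R' ≤ OrderDual.toDual X := h
      rw [if_neg h]
      exact (Finset.sum_eq_zero fun Y _ => if_neg fun hY => h' hY.1).symm
  rw [h1, Finset.sum_comm]
  -- For fixed `Y`, the values `μ(X, Y)` sum to zero over `R' ≤ X ≤ Y` unless `Y = R'`.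
  have h2 : ∀ Y : FlatPoset W A, (∑ X : FlatPoset W A, if R' ≤ X ∧ X ≤ Y then
        Polynomial.C (IncidenceAlgebra.mu ℤ X Y) *
          Polynomial.X ^ Module.finrank F (OrderDual.ofDual Y).1.direction else 0) =
      if R' = Y then Polynomial.X ^ Module.finrank F (OrderDual.ofDual Y).1.direction else 0 := by
    intro Y
    have := IncidenceAlgebra.sum_Icc_mu_left (𝕜 := ℤ) R' Y
    rw [← Finset.sum_filter, ← Finset.sum_mul, ← map_sum]
    have hIcc : (Finset.univ.filter fun X => R' ≤ X ∧ X ≤ Y) = Finset.Icc R' Y := by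
      ext X; simp
    rw [hIcc, this]
    split_ifs <;> simp
  rw [Finset.sum_congr rfl fun Y _ => h2 Y, Finset.sum_ite_eq, if_pos (Finset.mem_univ _)]
  rfl

end Arrangements

end HypArr

namespace HypArr

/-! ### Generic points of a flat -/

section Complements

variable {F V : Type*} [Field F] [AddCommGroup V] [Module F V]

/-- A vector space over an infinite field is not a finite union of proper subspaces. Since
everything passes through `0`, this applies to the traces of the members on `X.direction`. -/
theorem complement_nonempty_of_infinite [Infinite F] {X : AffineSubspace F V}
    {A : Finset (AffineSubspace F V)} (hX : (0 : V) ∈ X) (hA : ∀ H ∈ A, (0 : V) ∈ H)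
    (hXA : ∀ H ∈ A, ¬ X ≤ H) : (complement X A).Nonempty := by
  classical
  have hdir : ∀ {Y : AffineSubspace F V}, (0 : V) ∈ Y → ∀ v : V, v ∈ Y.direction ↔ v ∈ Y := by
    intro Y hY v
    rw [← AffineSubspace.vadd_mem_iff_mem_direction v hY, vadd_eq_add, add_zero]
  let s : Finset (Submodule F X.direction) :=
    A.image fun H => H.direction.comap X.direction.subtype
  have hs : ⊤ ∉ s := by
    intro h
    obtain ⟨H, hH, htop⟩ := Finset.mem_image.1 h
    refine hXA H hH fun v hv => ?_
    have : (⟨v, (hdir hX v).2 hv⟩ : X.direction) ∈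
        H.direction.comap X.direction.subtype := htop ▸ Submodule.mem_top
    exact (hdir (hA H hH) v).1 this
  obtain ⟨v, hv⟩ := (Set.ne_univ_iff_exists_notMem _).1
    (Subspace.biUnion_ne_univ_of_top_notMem hs)
  refine ⟨v.1, (hdir hX _).1 v.2, fun H hH hvH => hv ?_⟩
  exact Set.mem_biUnion (Finset.mem_image_of_mem _ hH) ((hdir (hA H hH) v.1).2 hvH)

theorem mem_iff_le_of_mem_complement_restriction {A : Finset (AffineSubspace F V)}
    {X H : AffineSubspace F V} {g : V} (hg : g ∈ complement X (restriction A X)) (hH : H ∈ A) :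
    g ∈ H ↔ X ≤ H := by
  classical
  refine ⟨fun h => ?_, fun h => h hg.1⟩
  by_contra hX
  exact hg.2 (H ⊓ X) (Finset.mem_image.2 ⟨H, Finset.mem_filter.2 ⟨hH, hX⟩, rfl⟩) ⟨h, hg.1⟩

end Complements

/-! ### Solvable subsystems of the translated arrangement -/

section Consistency

variable {F : Type*} [Field F] {m n : ℕ}

/-- The linear map `x ↦ (ρ_i · x)`, for `i ∈ S`. -/
noncomputable def pairing (ρ : Fin m → Fin n → F) (S : Finset (Fin m)) :
    (Fin n → F) →ₗ[F] (S → F) :=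
  Matrix.mulVecLin (Matrix.of fun i : S => ρ i)

theorem pairing_apply (ρ : Fin m → Fin n → F) (S : Finset (Fin m)) (x : Fin n → F) (i : S) :
    pairing ρ S x i = ρ i ⬝ᵥ x := rfl

/-- The vectors `g` for which the system `ρ_i · x = g_i`, `i ∈ S`, has a solution. -/
noncomputable def consistent (ρ : Fin m → Fin n → F) (S : Finset (Fin m)) :
    Submodule F (Fin m → F) :=
  (LinearMap.range (pairing ρ S)).comap (LinearMap.funLeft F F (Subtype.val : S → Fin m))

theorem mem_consistent_iff {ρ : Fin m → Fin n → F} {S : Finset (Fin m)} {g : Fin m → F} :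
    g ∈ consistent ρ S ↔ ∃ x, ∀ i ∈ S, ρ i ⬝ᵥ x = g i := by
  refine exists_congr fun x => ⟨fun h i hi => ?_, fun h => ?_⟩
  · exact congrFun h ⟨i, hi⟩
  · exact funext fun i => h i i.2

/-- If the pairing has rank `r`, its kernel has dimension `n - r`, and `consistent ρ S`, the kernel
of a surjection onto `F^S` modulo the range, has codimension `|S| - r`. The rank cancels. -/
theorem finrank_consistent (ρ : Fin m → Fin n → F) (S : Finset (Fin m)) :
    Module.finrank F (LinearMap.ker (pairing ρ S)) + Module.finrank F (consistent ρ S) =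
      n + (m - S.card) := by
  let f := (LinearMap.range (pairing ρ S)).mkQ ∘ₗ
    LinearMap.funLeft F F (Subtype.val : S → Fin m)
  have hker : consistent ρ S = LinearMap.ker f := by
    rw [LinearMap.ker_comp, Submodule.ker_mkQ, consistent]
  have hsurj : LinearMap.range f = ⊤ := LinearMap.range_eq_top.2
    ((Submodule.mkQ_surjective _).comp
      (LinearMap.funLeft_surjective_of_injective F F _ Subtype.val_injective))
  have h1 := LinearMap.finrank_range_add_finrank_ker f
  have h2 := LinearMap.finrank_range_add_finrank_ker (pairing ρ S)
  have h3 := Submodule.finrank_quotient_add_finrank (LinearMap.range (pairing ρ S))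
  rw [hsurj, finrank_top] at h1
  rw [hker]
  simp only [Module.finrank_fintype_fun_eq_card, Fintype.card_fin, Fintype.card_coe] at h1 h2 h3
  have := S.card_le_univ
  rw [Fintype.card_fin] at this
  omega

theorem mem_inf_hyperplane_iff {ρ : Fin m → Fin n → F} {S : Finset (Fin m)} {g : Fin m → F}
    {x : Fin n → F} : x ∈ (⊤ ⊓ S.inf fun i => hyperplane (ρ i) (g i) :
      AffineSubspace F (Fin n → F)) ↔ ∀ i ∈ S, ρ i ⬝ᵥ x = g i := by
  rw [top_inf_eq, mem_finset_inf_iff]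
  rfl

theorem inf_hyperplane_ne_bot_iff {ρ : Fin m → Fin n → F} {S : Finset (Fin m)} {g : Fin m → F} :
    (⊤ ⊓ S.inf fun i => hyperplane (ρ i) (g i) : AffineSubspace F (Fin n → F)) ≠ ⊥ ↔
      g ∈ consistent ρ S := by
  rw [← AffineSubspace.nonempty_iff_ne_bot, mem_consistent_iff]
  exact exists_congr fun x => mem_inf_hyperplane_iff

theorem direction_inf_hyperplane {ρ : Fin m → Fin n → F} {S : Finset (Fin m)} {g : Fin m → F}
    (h : g ∈ consistent ρ S) :
    (⊤ ⊓ S.inf fun i => hyperplane (ρ i) (g i) : AffineSubspace F (Fin n → F)).direction =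
      LinearMap.ker (pairing ρ S) := by
  obtain ⟨x, hx⟩ := mem_consistent_iff.1 h
  ext v
  rw [← AffineSubspace.vadd_mem_iff_mem_direction v (mem_inf_hyperplane_iff.2 hx),
    mem_inf_hyperplane_iff, LinearMap.mem_ker, funext_iff, Subtype.forall]
  refine forall₂_congr fun i hi => ?_
  rw [pairing_apply, vadd_eq_add, dotProduct_add, hx i hi]
  simp

-- Whitney's theorem for families: the sum runs over index sets even if some members coincide, and
-- its nonempty intersections are the solvable subsystems.
open Classical in
theorem charPoly_translate (ρ : Fin m → Fin n → F) (g : Fin m → F) :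
    charPoly ⊤ (translate ρ g) = ∑ S : Finset (Fin m), if g ∈ consistent ρ S then
      (-1 : Polynomial ℤ) ^ S.card *
        Polynomial.X ^ Module.finrank F (LinearMap.ker (pairing ρ S)) else 0 := by
  rw [translate, charPoly_eq_sum_powerset, Finset.powerset_univ]
  refine Finset.sum_congr rfl fun S _ => ?_
  by_cases h : g ∈ consistent ρ S
  · rw [if_pos (inf_hyperplane_ne_bot_iff.2 h), if_pos h, direction_inf_hyperplane h]
  · rw [if_neg (fun h' => h (inf_hyperplane_ne_bot_iff.1 h')), if_neg h]

/-! ### Solvability in terms of circuits -/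

variable {M : Matroid (Fin m)} {ρ : Fin m → Fin n → F}

theorem isCircuitVector_circuitVector (hρ : IsRepresentation M ρ) {I : Finset (Fin m)}
    (hI : M.IsCircuit (I : Set (Fin m))) : IsCircuitVector ρ I (circuitVector ρ I) := by
  have h := exists_isCircuitVector hρ hI
  rw [circuitVector, dif_pos h]
  exact h.choose_spec

/-- The circuit vectors of the circuits contained in `S` span the relations supported in `S`. -/
theorem dotProduct_eq_zero_of_forall_circuit (hρ : IsRepresentation M ρ) {S : Finset (Fin m)}
    {g : Fin m → F} (hg : ∀ I : Finset (Fin m), M.IsCircuit (I : Set (Fin m)) → I ⊆ S →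
      circuitVector ρ I ⬝ᵥ g = 0) (c : Fin m → F) (hcS : ∀ i, c i ≠ 0 → i ∈ S)
    (hc : ∑ i, c i • ρ i = 0) : c ⬝ᵥ g = 0 := by
  classical
  induction hk : (Finset.univ.filter fun i => c i ≠ 0).card using Nat.strong_induction_on
    generalizing c with
  | _ k ih =>
    by_cases hc0 : c = 0
    · simp [hc0]
    set J := Finset.univ.filter fun i => c i ≠ 0 with hJ
    have hdep : M.Dep (J : Set (Fin m)) := by
      refine ⟨fun h => hc0 (funext fun i => ?_), by simp [hρ.1]⟩
      by_contra hi
      refine hi (linearIndepOn_finset_iff.1 ((hρ.2 _).1 h) c ?_ i (by simpa [hJ] using hi))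
      rw [← hc]
      exact Finset.sum_subset (Finset.subset_univ _) fun j _ hj => by
        have : c j = 0 := by simpa [hJ] using hj
        simp [this]
    obtain ⟨I, hIJ, hI⟩ := hdep.exists_isCircuit_subset
    lift I to Finset (Fin m) using I.toFinite
    have hIJ : I ⊆ J := by exact_mod_cast hIJ
    have hd := isCircuitVector_circuitVector hρ hI
    have hdg := hg I hI fun i hi => hcS i (Finset.mem_filter.1 (hIJ hi)).2
    generalize circuitVector ρ I = d at hd hdg
    -- Subtracting `(c i / d i) • d` kills coordinate `i` and creates no new support because `I ⊆
    -- J`: the support shrinks.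
    obtain ⟨i, hi⟩ : I.Nonempty := by exact_mod_cast hI.nonempty
    have hdi := (hd.2 i).2 hi
    have hsupp : ∀ j, (c - (c i / d i) • d) j ≠ 0 → j ∈ J.erase i := by
      intro j hj
      refine Finset.mem_erase.2 ⟨?_, Finset.mem_filter.2 ⟨Finset.mem_univ _, fun h => hj ?_⟩⟩
      · rintro rfl
        exact hj (by simp [hdi])
      · have hjI : j ∉ I := fun hjI => (Finset.mem_filter.1 (hIJ hjI)).2 h
        have : d j = 0 := by
          by_contra h'
          exact hjI ((hd.2 j).1 h')
        simp [h, this]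
    have h := ih _ ?_ (c - (c i / d i) • d)
      (fun j hj => hcS j (Finset.mem_filter.1 (Finset.mem_of_mem_erase (hsupp j hj))).2) ?_ rfl
    · rwa [sub_dotProduct, smul_dotProduct, hdg, smul_zero, sub_zero] at h
    · rw [← hk]
      refine Finset.card_lt_card ((Finset.ssubset_iff_of_subset ?_).2 ⟨i, hIJ hi, ?_⟩)
      · exact fun j hj => Finset.mem_of_mem_erase (hsupp j (Finset.mem_filter.1 hj).2)
      · exact fun h => Finset.notMem_erase i J (hsupp i (Finset.mem_filter.1 h).2)
    · simp only [Pi.sub_apply, Pi.smul_apply, smul_eq_mul, sub_smul, mul_smul,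
        Finset.sum_sub_distrib, ← Finset.smul_sum, hc, hd.1, smul_zero, sub_zero]

theorem sum_smul_dotProduct (ρ : Fin m → Fin n → F) (c : Fin m → F) (x : Fin n → F) :
    (∑ i, c i • ρ i) ⬝ᵥ x = c ⬝ᵥ fun i => ρ i ⬝ᵥ x := by
  rw [sum_dotProduct]
  simp only [smul_dotProduct, smul_eq_mul]
  rfl

theorem mem_consistent_iff_forall_circuit (hρ : IsRepresentation M ρ) {S : Finset (Fin m)}
    {g : Fin m → F} : g ∈ consistent ρ S ↔ ∀ I : Finset (Fin m),
      M.IsCircuit (I : Set (Fin m)) → I ⊆ S → circuitVector ρ I ⬝ᵥ g = 0 := by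
  classical
  constructor
  · intro h I hI hIS
    obtain ⟨x, hx⟩ := mem_consistent_iff.1 h
    have hd := isCircuitVector_circuitVector hρ hI
    have h0 := sum_smul_dotProduct ρ (circuitVector ρ I) x
    rw [hd.1, zero_dotProduct] at h0
    rw [h0]
    refine Finset.sum_congr rfl fun i _ => ?_
    by_cases hi : i ∈ I
    · exact congrArg _ (hx i (hIS hi)).symm
    · have : circuitVector ρ I i = 0 := by
        by_contra h'
        exact hi ((hd.2 i).1 h')
      simp [this]
  · intro h
    by_contra hg
    -- Duality: if `g` on `S` is outside the range, a functional `f` vanishes on the range but not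
    -- at `g`. Its coefficients `c` form a relation supported in `S`, which the circuit conditions
    -- force to vanish at `g`.
    obtain ⟨f, hfg, hf⟩ := Submodule.exists_le_ker_of_notMem
      (p := LinearMap.range (pairing ρ S)) (v := fun i : S => g i) hg
    let c : Fin m → F := fun i => if hi : i ∈ S then f (Pi.single ⟨i, hi⟩ 1) else 0
    have hcf : ∀ y : Fin m → F, c ⬝ᵥ y = f fun i : S => y i := by
      intro y
      rw [LinearMap.pi_apply_eq_sum_univ f, dotProduct,
        ← Finset.sum_subset (Finset.subset_univ S) fun i _ hi => by simp [c, hi],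
        ← Finset.sum_coe_sort S]
      refine Finset.sum_congr rfl fun i _ => ?_
      simp only [c, i.2, dif_pos, smul_eq_mul, mul_comm]
      congr 2
      ext j
      simp [Pi.single_apply, eq_comm]
    refine hfg ?_
    rw [← hcf]
    refine dotProduct_eq_zero_of_forall_circuit hρ h c (fun i hi => ?_) ?_
    · by_contra hiS
      exact hi (dif_neg hiS)
    · refine dotProduct_eq_zero _ fun x => ?_
      rw [sum_smul_dotProduct, hcf]
      exact hf ⟨x, rfl⟩

theorem consistent_mem_flats (hρ : IsRepresentation M ρ) (S : Finset (Fin m)) :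
    (consistent ρ S).toAffineSubspace ∈ flats ⊤ (circuitArr M ρ) := by
  classical
  let T : Finset (AffineSubspace F (Fin m → F)) :=
    (Finset.univ.filter fun I : Finset (Fin m) => M.IsCircuit (I : Set (Fin m)) ∧ I ⊆ S).image
      fun I => hyperplane (circuitVector ρ I) 0
  have hT : ⊤ ⊓ T.inf id = (consistent ρ S).toAffineSubspace := by
    ext g
    rw [top_inf_eq, mem_finset_inf_iff, Submodule.mem_toAffineSubspace,
      mem_consistent_iff_forall_circuit hρ]
    simp only [T, Finset.forall_mem_image, Finset.mem_filter, Finset.mem_univ, true_and, and_imp]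
    rfl
  rw [← hT]
  refine inf_mem_flats (Finset.image_subset_image ?_) ?_
  · exact Finset.monotone_filter_right _ fun I _ hI => hI.1
  · rw [hT, ← AffineSubspace.nonempty_iff_ne_bot]
    exact ⟨0, (consistent ρ S).zero_mem⟩

/-- A generic point of `X` lies only on those circuit hyperplanes that contain `X`, and such
hyperplanes cut out `consistent ρ S`. -/
theorem mem_consistent_iff_le (hρ : IsRepresentation M ρ) {X : AffineSubspace F (Fin m → F)}
    {g : Fin m → F} (hg : g ∈ complement X (restriction (circuitArr M ρ) X))
    (S : Finset (Fin m)) :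
    g ∈ consistent ρ S ↔ X ≤ (consistent ρ S).toAffineSubspace := by
  classical
  refine ⟨fun h y hy => ?_, fun h => h hg.1⟩
  rw [Submodule.mem_toAffineSubspace, mem_consistent_iff_forall_circuit hρ]
  intro I hI hIS
  have hmem : hyperplane (circuitVector ρ I) 0 ∈ circuitArr M ρ :=
    Finset.mem_image.2 ⟨I, Finset.mem_filter.2 ⟨Finset.mem_univ _, hI⟩, rfl⟩
  exact (mem_iff_le_of_mem_complement_restriction hg hmem).1
    ((mem_consistent_iff_forall_circuit hρ).1 h I hI hIS) hy

/-! ### The generic polynomial and the decomposition formula -/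

open Classical in
/-- The characteristic polynomial of `A_g` for a generic point `g` of `X`, in terms of `X`. -/
noncomputable def genericPoly (ρ : Fin m → Fin n → F) (X : AffineSubspace F (Fin m → F)) :
    Polynomial ℤ :=
  ∑ S : Finset (Fin m), if X ≤ (consistent ρ S).toAffineSubspace then
    (-1 : Polynomial ℤ) ^ S.card *
      Polynomial.X ^ Module.finrank F (LinearMap.ker (pairing ρ S)) else 0

theorem charPoly_translate_eq_genericPoly (hρ : IsRepresentation M ρ)
    {X : AffineSubspace F (Fin m → F)} {g : Fin m → F}
    (hg : g ∈ complement X (restriction (circuitArr M ρ) X)) :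
    charPoly ⊤ (translate ρ g) = genericPoly ρ X := by
  classical
  rw [charPoly_translate, genericPoly]
  exact Finset.sum_congr rfl fun S _ => if_congr (mem_consistent_iff_le hρ hg S) rfl rfl

theorem flatPoly_eq_genericPoly (hρ : IsRepresentation M ρ) {X : AffineSubspace F (Fin m → F)}
    (h : (complement X (restriction (circuitArr M ρ) X)).Nonempty) :
    flatPoly M ρ X = genericPoly ρ X := by
  rw [flatPoly, dif_pos h]
  exact charPoly_translate_eq_genericPoly hρ h.choose_spec

/-- No generic point is needed: `genericPoly` is defined for every flat, so this holds over finite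
and infinite fields alike. -/
theorem sum_genericPoly_mul_charPoly (hρ : IsRepresentation M ρ) :
    ∑ X ∈ flats ⊤ (circuitArr M ρ),
      genericPoly ρ X * charPoly X (restriction (circuitArr M ρ) X) =
      Polynomial.X ^ n * (Polynomial.X - 1) ^ m := by
  classical
  simp only [genericPoly, Finset.sum_mul, ite_mul, zero_mul]
  rw [Finset.sum_comm]
  have hS : ∀ S : Finset (Fin m), (∑ X ∈ flats ⊤ (circuitArr M ρ),
      if X ≤ (consistent ρ S).toAffineSubspace then (-1 : Polynomial ℤ) ^ S.card *
        Polynomial.X ^ Module.finrank F (LinearMap.ker (pairing ρ S)) *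
          charPoly X (restriction (circuitArr M ρ) X) else 0) =
      Polynomial.X ^ n * ((-1) ^ S.card * Polynomial.X ^ (m - S.card)) := by
    intro S
    have h := sum_charPoly_restriction (consistent_mem_flats hρ S)
    rw [Submodule.toAffineSubspace_direction] at h
    simp only [← mul_ite_zero]
    rw [← Finset.mul_sum, h, mul_assoc, ← pow_add, finrank_consistent, pow_add]
    ring
  rw [Finset.sum_congr rfl fun S _ => hS S, ← Finset.mul_sum, ← Finset.powerset_univ]
  have h := Finset.sum_pow_mul_eq_add_pow (-1 : Polynomial ℤ) Polynomial.X
    (Finset.univ : Finset (Fin m))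
  rw [Finset.card_univ, Fintype.card_fin] at h
  rw [h, neg_add_eq_sub]

theorem complement_restriction_nonempty [Infinite F] {X : AffineSubspace F (Fin m → F)}
    (hX : X ∈ flats ⊤ (circuitArr M ρ)) :
    (complement X (restriction (circuitArr M ρ) X)).Nonempty := by
  classical
  have hA : ∀ H ∈ circuitArr M ρ, (0 : Fin m → F) ∈ H := by
    intro H hH
    obtain ⟨I, -, rfl⟩ := Finset.mem_image.1 hH
    exact dotProduct_zero _
  have h0 : (0 : Fin m → F) ∈ X := by
    rw [(mem_flats_iff.1 hX).2, top_inf_eq, mem_finset_inf_iff]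
    exact fun H hH => hA H (Finset.mem_filter.1 hH).1
  refine complement_nonempty_of_infinite h0 (fun K hK => ?_) fun K hK hXK => ?_ <;>
    obtain ⟨H, hH, rfl⟩ := Finset.mem_image.1 hK
  · exact ⟨hA H (Finset.mem_filter.1 hH).1, h0⟩
  · exact (Finset.mem_filter.1 hH).2 (hXK.trans inf_le_left)

end Consistency

end HypArr

theorem theorem4p2 {F : Type*} [Field F] {m n : ℕ} (M : Matroid (Fin m))
    (ρ : Fin m → Fin n → F) (hρ : HypArr.IsRepresentation M ρ) :
    -- `χ(X, t)` is well defined: it is the characteristic polynomial of every `A_g`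
    (∀ X ∈ HypArr.flats ⊤ (HypArr.circuitArr M ρ),
      ∀ g ∈ HypArr.complement X (HypArr.restriction (HypArr.circuitArr M ρ) X),
        HypArr.charPoly ⊤ (HypArr.translate ρ g) = HypArr.flatPoly M ρ X) ∧
    -- finite fields; where `χ(X, t)` is a mere convention, it is multiplied by zero
    (Finite F →
      (∀ X ∈ HypArr.flats ⊤ (HypArr.circuitArr M ρ),
        HypArr.complement X (HypArr.restriction (HypArr.circuitArr M ρ) X) = ∅ →
          (HypArr.charPoly X (HypArr.restriction (HypArr.circuitArr M ρ) X)).eval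
            (Nat.card F : ℤ) = 0) ∧
      ∑ X ∈ HypArr.flats ⊤ (HypArr.circuitArr M ρ),
        (HypArr.flatPoly M ρ X).eval (Nat.card F : ℤ) *
          (HypArr.charPoly X (HypArr.restriction (HypArr.circuitArr M ρ) X)).eval
            (Nat.card F : ℤ) =
        (Nat.card F : ℤ) ^ n * ((Nat.card F : ℤ) - 1) ^ m) ∧
    -- infinite fields; here `χ(X, t)` is never a mere convention
    (Infinite F →
      (∀ X ∈ HypArr.flats ⊤ (HypArr.circuitArr M ρ),
        (HypArr.complement X (HypArr.restriction (HypArr.circuitArr M ρ) X)).Nonempty) ∧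
      ∑ X ∈ HypArr.flats ⊤ (HypArr.circuitArr M ρ),
        HypArr.flatPoly M ρ X *
          HypArr.charPoly X (HypArr.restriction (HypArr.circuitArr M ρ) X) =
        (Polynomial.X : Polynomial ℤ) ^ n * (Polynomial.X - 1) ^ m) := by
  have hfin : Finite F → ∀ X : AffineSubspace F (Fin m → F),
      HypArr.complement X (HypArr.restriction (HypArr.circuitArr M ρ) X) = ∅ →
        (HypArr.charPoly X (HypArr.restriction (HypArr.circuitArr M ρ) X)).eval
          (Nat.card F : ℤ) = 0 := by
    intro _ X hX
    rw [HypArr.charPoly_eval_natCard, hX]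
    simp
  have hsum := HypArr.sum_genericPoly_mul_charPoly hρ
  refine ⟨fun X _ g hg => ?_, fun _ => ⟨fun X _ => hfin inferInstance X, ?_⟩,
    fun _ => ⟨fun X hX => HypArr.complement_restriction_nonempty hX, ?_⟩⟩
  · rw [HypArr.charPoly_translate_eq_genericPoly hρ hg,
      HypArr.flatPoly_eq_genericPoly hρ ⟨g, hg⟩]
  · have h := congrArg (Polynomial.eval (Nat.card F : ℤ)) hsum
    simp only [Polynomial.eval_finsetSum, Polynomial.eval_mul, Polynomial.eval_pow,
      Polynomial.eval_X, Polynomial.eval_sub, Polynomial.eval_one] at h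
    rw [← h]
    refine Finset.sum_congr rfl fun X _ => ?_
    rcases Set.eq_empty_or_nonempty
      (HypArr.complement X (HypArr.restriction (HypArr.circuitArr M ρ) X)) with hX | hX
    -- Here `flatPoly` and `genericPoly` may differ, but both are multiplied by zero.
    · rw [hfin inferInstance X hX, mul_zero, mul_zero]
    · rw [HypArr.flatPoly_eq_genericPoly hρ hX]
  · rw [← hsum]
    exact Finset.sum_congr rfl fun X hX => by
      rw [HypArr.flatPoly_eq_genericPoly hρ (HypArr.complement_restriction_nonempty hX)]
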